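/- Let $n\ge 1$, $1<q\le p<\infty$, $1<s<\infty$ and $\gamma>0$ with \[ \frac nq-\frac np<\gamma<n-\frac np . \] For measurable (real- or complex-valued) functions $f$ on $\mathbb R^n$ put \[ \|f\|_{L^{p,\infty}}=\sup_{\tau>0}\tau\,\|\chi_{\{|f|>\tau\}}\|_{L^p},\qquad \|f\|_{\mathcal M^p_q}=\sup_{x\in\mathbb R^n,\,r>0} r^{\frac np-\frac nq}\Big(\int_{B(x,r)}|f(y)|^q\,dy\Big)^{\frac1q}, \] where $B(x,r)$ is the ball with center $x$ and radius $r$, let $L^{p,\infty}(\mathbb R^n)$ and $\mathcal M^p_q(\mathbb R^n)$ be the spaces of measurable functions for which the respective quantity is finite, and let \[ e^{t\Delta}g(x)=\frac1{\sqrt{(4\pi t)^n}}\int_{\mathbb R^n}\exp\Big(-\frac{|x-y|^2}{4t}\Big)g(y)\,dy ,\qquad t>0 . \] Then for all $t>0$ and $f\in\mathcal M^p_q(\mathbb R^n)$ the integral defining $e^{t\Delta}[|\cdot|^{-\gamma}f](x)$ converges absolutely for every $x\in\mathbb R^n$, and the following hold. (1) If $q\le s$, there is a constant $C>0$ such that for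 all $t>0$ and all $f\in\mathcal M^p_q(\mathbb R^n)$ the function $e^{t\Delta}[|\cdot|^{-\gamma}f]$ lies in $L^{s,\infty}(\mathbb R^n)$ and \[ \|e^{t\Delta}[|\cdot|^{-\gamma}f]\|_{L^{s,\infty}}\le C\,t^{-\frac n2\left(\frac1p-\frac1s\right)-\frac\gamma2}\,\|f\|_{\mathcal M^p_q}. \] (2) If $q<s$, there is a constant $C>0$ such that for all $t>0$ and all $f\in\mathcal M^p_q(\mathbb R^n)$ the function $e^{t\Delta}[|\cdot|^{-\gamma}f]$ lies in $L^{s}(\mathbb R^n)$ and \[ \|e^{t\Delta}[|\cdot|^{-\gamma}f]\|_{L^{s}}\le C\,t^{-\frac n2\left(\frac1p-\frac1s\right)-\frac\gamma2}\,\|f\|_{\mathcal M^p_q}. \] (3) If $q<p$, then $L^{p,\infty}(\mathbb R^n)\subset\mathcal M^p_q(\mathbb R^n)$ with $\|f\|_{\mathcal M^p_q}\le C\|f\|_{L^{p,\infty}}$ for a constant $C>0$ independent of $f$, and the inclusion is proper. (So (1) and (2) improve the corresponding estimates with $\|f\|_{L^{p,\infty}}$ on the right-hand side.) -/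

import Mathlib

open MeasureTheory Set
open scoped ENNReal

noncomputable section

namespace HeatMorrey

/-- The heat semigroup on `ℝⁿ`, given by convolution with the Gauss kernel. -/
def heatSemigroup {𝕜 : Type*} [RCLike 𝕜] {n : ℕ} (t : ℝ)
    (f : EuclideanSpace ℝ (Fin n) → 𝕜) (x : EuclideanSpace ℝ (Fin n)) : 𝕜 :=
  (1 / Real.sqrt ((4 * Real.pi * t) ^ n)) •
    ∫ y : EuclideanSpace ℝ (Fin n), Real.exp (-(‖x - y‖ ^ 2 / (4 * t))) • f y

/-- The function `x ↦ |x|^(-γ) f(x)` (its value at the single point `0` is immaterial). -/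
def weighted {𝕜 : Type*} [RCLike 𝕜] {n : ℕ} (γ : ℝ)
    (f : EuclideanSpace ℝ (Fin n) → 𝕜) (x : EuclideanSpace ℝ (Fin n)) : 𝕜 :=
  (‖x‖ ^ (-γ)) • f x

/-- The weak Lebesgue quasi-norm `sup_{t>0} t ‖χ_{|f|>t}‖_{L^p}`, with values in `[0,∞]`. -/
def weakLpNorm {𝕜 : Type*} [RCLike 𝕜] {n : ℕ} (p : ℝ)
    (f : EuclideanSpace ℝ (Fin n) → 𝕜) : ℝ≥0∞ :=
  ⨆ (t : ℝ) (_ : 0 < t), ENNReal.ofReal t *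
    eLpNorm ({x | t < ‖f x‖}.indicator (fun _ => (1 : ℝ))) (ENNReal.ofReal p) volume

/-- Membership in `L^{p,∞}(ℝⁿ)`. -/
def MemWeakLp {𝕜 : Type*} [RCLike 𝕜] {n : ℕ} (p : ℝ)
    (f : EuclideanSpace ℝ (Fin n) → 𝕜) : Prop :=
  AEStronglyMeasurable f volume ∧ weakLpNorm p f < ∞

/-- The Morrey norm `sup_{x, t>0} t^(n/p - n/q) (∫_{B(x,t)} |f|^q)^(1/q)`, with values
in `[0,∞]`. -/
def morreyNorm {𝕜 : Type*} [RCLike 𝕜] {n : ℕ} (p q : ℝ)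
    (f : EuclideanSpace ℝ (Fin n) → 𝕜) : ℝ≥0∞ :=
  ⨆ (x : EuclideanSpace ℝ (Fin n)) (t : ℝ) (_ : 0 < t),
    ENNReal.ofReal (t ^ ((n : ℝ) / p - (n : ℝ) / q)) *
      eLpNorm f (ENNReal.ofReal q) (volume.restrict (Metric.ball x t))

/-- Membership in the Morrey space `M^p_q(ℝⁿ)`. -/
def MemMorrey {𝕜 : Type*} [RCLike 𝕜] {n : ℕ} (p q : ℝ)
    (f : EuclideanSpace ℝ (Fin n) → 𝕜) : Prop :=
  AEStronglyMeasurable f volume ∧ morreyNorm p q f < ∞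

end HeatMorrey

end

set_option linter.unusedSectionVars false

/-! Cut `|x|^{-γ} f` at the parabolic scale `√t`. On balls about the origin, the Morrey norm
controls `∫ |f|^q` by a power of the radius and, through Hölder, `∫ |f|` by `r^{n-n/p}`. Summing the
weight over dyadic shells, the inner sum converges because `γ < n - n/p` and puts the inner piece in
`L¹`. The outer sum converges because `n/q - n/p < γ` and puts the outer piece in `L^q`. The norms
are multiples of `√t^{n-n/p-γ}` and `√t^{n/q-n/p-γ}`.

The Gauss kernel is a probability density bounded by `(4πt)^{-n/2}`, so by Young it maps `L^r` to
`L^s`, `r ≤ s`, at the cost `t^{-(n/2)(1/r-1/s)}`. With `r = 1` and `r = q` both pieces end with the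
same power of `t`. This gives the strong bound even at `s = q`; the weak bound follows by Chebyshev.

The embedding of `L^{p,∞}` is a dyadic layer-cake estimate with the base level adapted to the radius
of the ball. It is proper because of unit balls at exponentially spread centers: their union has
infinite measure, but a ball of radius `r` sees only `O(log r)` of them when `r` is large. -/

namespace HeatMorrey

/-! ### Power weights summed over dyadic shells -/

section Dyadic

variable {E : Type*} [NormedAddCommGroup E] [MeasurableSpace E] {μ : Measure E}

/-- The dyadic shell `ρ ≤ ‖y‖ ≤ 2ρ`. -/
def shell (E : Type*) [NormedAddCommGroup E] (ρ : ℝ) : Set E := {y | ρ ≤ ‖y‖ ∧ ‖y‖ ≤ 2 * ρ}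

theorem measurableSet_shell [OpensMeasurableSpace E] (ρ : ℝ) : MeasurableSet (shell E ρ) :=
  ((isClosed_le continuous_const continuous_norm).inter
    (isClosed_le continuous_norm continuous_const)).measurableSet

/-- The weight is at most `ρ^{-β}` on the shell. The radius `4ρ` leaves room to fit the closed shell
into an open ball. -/
theorem setLIntegral_shell_rpow_mul_le [OpensMeasurableSpace E] {φ : E → ℝ≥0∞} {a β ρ : ℝ}
    {M : ℝ≥0∞} (hβ : 0 ≤ β) (hρ : 0 < ρ)
    (h : ∀ r : ℝ, 0 < r → ∫⁻ y in Metric.ball 0 r, φ y ∂μ ≤ M * ENNReal.ofReal (r ^ a)) :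
    ∫⁻ y in shell E ρ, ENNReal.ofReal (‖y‖ ^ (-β)) * φ y ∂μ ≤
      M * ENNReal.ofReal (4 ^ a * ρ ^ (a - β)) := by
  have hsub : shell E ρ ⊆ Metric.ball 0 (4 * ρ) := fun y hy => by
    rw [mem_ball_zero_iff]; linarith [hy.2]
  calc ∫⁻ y in shell E ρ, ENNReal.ofReal (‖y‖ ^ (-β)) * φ y ∂μ
      ≤ ∫⁻ y in shell E ρ, ENNReal.ofReal (ρ ^ (-β)) * φ y ∂μ := by
        refine setLIntegral_mono' (measurableSet_shell ρ) fun y hy => ?_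
        gcongr ENNReal.ofReal ?_ * _
        exact Real.rpow_le_rpow_of_nonpos hρ hy.1 (by linarith)
    _ = ENNReal.ofReal (ρ ^ (-β)) * ∫⁻ y in shell E ρ, φ y ∂μ :=
        lintegral_const_mul' _ _ ENNReal.ofReal_ne_top
    _ ≤ ENNReal.ofReal (ρ ^ (-β)) * (M * ENNReal.ofReal ((4 * ρ) ^ a)) := by
        gcongr
        exact (lintegral_mono_set hsub).trans (h _ (by positivity))
    _ = M * ENNReal.ofReal (4 ^ a * ρ ^ (a - β)) := by
        rw [mul_left_comm, ← ENNReal.ofReal_mul (by positivity),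
          Real.mul_rpow (by norm_num) hρ.le, sub_eq_add_neg, Real.rpow_add hρ]
        congr 2; ring

/-- The shell bounds form a geometric series of ratio `c^{a-β}`. Taking `c = 1/2` runs towards the
origin, `c = 2` towards infinity. -/
theorem setLIntegral_iUnion_shell_rpow_mul_le [OpensMeasurableSpace E] {φ : E → ℝ≥0∞}
    {a β R c : ℝ} {M : ℝ≥0∞} (hβ : 0 ≤ β) (hR : 0 < R) (hc : 0 < c) (hc1 : c ^ (a - β) < 1)
    (h : ∀ r : ℝ, 0 < r → ∫⁻ y in Metric.ball 0 r, φ y ∂μ ≤ M * ENNReal.ofReal (r ^ a)) :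
    ∫⁻ y in ⋃ k : ℕ, shell E (R * c ^ k), ENNReal.ofReal (‖y‖ ^ (-β)) * φ y ∂μ ≤
      M * ENNReal.ofReal (4 ^ a * (1 - c ^ (a - β))⁻¹ * R ^ (a - β)) := by
  have hcpos : 0 < c ^ (a - β) := Real.rpow_pos_of_pos hc _
  have hs : Summable fun k : ℕ => 4 ^ a * R ^ (a - β) * (c ^ (a - β)) ^ k :=
    (summable_geometric_of_lt_one hcpos.le hc1).mul_left _
  calc _ ≤ ∑' k : ℕ, ∫⁻ y in shell E (R * c ^ k), ENNReal.ofReal (‖y‖ ^ (-β)) * φ y ∂μ :=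
        lintegral_iUnion_le _ _
    _ ≤ ∑' k : ℕ, M * ENNReal.ofReal (4 ^ a * R ^ (a - β) * (c ^ (a - β)) ^ k) := by
        refine ENNReal.tsum_le_tsum fun k => ?_
        refine (setLIntegral_shell_rpow_mul_le hβ (by positivity) h).trans_eq ?_
        rw [Real.mul_rpow hR.le (by positivity), ← Real.rpow_natCast c k,
          ← Real.rpow_natCast _ k, ← Real.rpow_mul hc.le, ← Real.rpow_mul hc.le, mul_assoc,
          mul_comm (k : ℝ)]
    _ = M * ENNReal.ofReal (4 ^ a * (1 - c ^ (a - β))⁻¹ * R ^ (a - β)) := by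
        rw [ENNReal.tsum_mul_left, ← ENNReal.ofReal_tsum_of_nonneg (fun k => by positivity) hs,
          tsum_mul_left, tsum_geometric_of_lt_one hcpos.le hc1]
        congr 2; ring

/-- If `∫_{B(0,r)} φ ≤ M r^a` for all `r`, then `|y|^{-β} φ` is integrable near `0` when `β < a`. -/
theorem setLIntegral_ball_rpow_mul_le [OpensMeasurableSpace E] {φ : E → ℝ≥0∞} {a β R : ℝ}
    {M : ℝ≥0∞} (hβ : 0 < β) (hβa : β < a) (hR : 0 < R)
    (h : ∀ r : ℝ, 0 < r → ∫⁻ y in Metric.ball 0 r, φ y ∂μ ≤ M * ENNReal.ofReal (r ^ a)) :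
    ∫⁻ y in Metric.ball 0 R, ENNReal.ofReal (‖y‖ ^ (-β)) * φ y ∂μ ≤
      M * ENNReal.ofReal (4 ^ a * (1 - (1 / 2) ^ (a - β))⁻¹ * R ^ (a - β)) := by
  refine le_trans ?_ (setLIntegral_iUnion_shell_rpow_mul_le hβ.le hR one_half_pos
    (Real.rpow_lt_one (by norm_num) (by norm_num) (by linarith)) h)
  have hsub : Metric.ball (0 : E) R ⊆ {0} ∪ ⋃ k : ℕ, shell E (R * (1 / 2) ^ k) := by
    intro y hy
    rw [mem_ball_zero_iff] at hy
    rcases eq_or_ne y 0 with rfl | hy0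
    · exact Or.inl rfl
    have hy0 : 0 < ‖y‖ := norm_pos_iff.2 hy0
    obtain ⟨k, hk1, hk2⟩ := exists_nat_pow_near_of_lt_one (div_pos hy0 hR)
      ((div_le_one hR).2 hy.le) (one_half_pos (α := ℝ)) one_half_lt_one
    rw [lt_div_iff₀ hR] at hk1
    rw [div_le_iff₀ hR] at hk2
    refine Or.inr (mem_iUnion.2 ⟨k + 1, by linarith, ?_⟩)
    rw [pow_succ]; linarith
  refine (lintegral_mono_set hsub).trans ((lintegral_union_le _ _ _).trans ?_)
  -- The origin lies in no shell and may be an atom of `μ`; it contributes nothing because `0 ^ (-β)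
  -- = 0` by convention when `β ≠ 0`.
  have h0 : ∫⁻ y in ({0} : Set E), ENNReal.ofReal (‖y‖ ^ (-β)) * φ y ∂μ = 0 := by
    rw [setLIntegral_congr_fun (g := 0) (measurableSet_singleton 0)]
    · simp
    · rintro y rfl
      simp [Real.zero_rpow (neg_ne_zero.2 hβ.ne')]
  rw [h0, zero_add]

/-- If `∫_{B(0,r)} φ ≤ M r^a` for all `r`, then `|y|^{-β} φ` is integrable at `∞` when `a < β`. -/
theorem setLIntegral_compl_ball_rpow_mul_le [OpensMeasurableSpace E] {φ : E → ℝ≥0∞}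
    {a β R : ℝ} {M : ℝ≥0∞} (hβ : 0 ≤ β) (hβa : a < β) (hR : 0 < R)
    (h : ∀ r : ℝ, 0 < r → ∫⁻ y in Metric.ball 0 r, φ y ∂μ ≤ M * ENNReal.ofReal (r ^ a)) :
    ∫⁻ y in (Metric.ball 0 R)ᶜ, ENNReal.ofReal (‖y‖ ^ (-β)) * φ y ∂μ ≤
      M * ENNReal.ofReal (4 ^ a * (1 - 2 ^ (a - β))⁻¹ * R ^ (a - β)) := by
  refine le_trans (lintegral_mono_set ?_) (setLIntegral_iUnion_shell_rpow_mul_le hβ hR two_pos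
    (Real.rpow_lt_one_of_one_lt_of_neg (by norm_num) (by linarith)) h)
  intro y hy
  rw [mem_compl_iff, mem_ball_zero_iff, not_lt] at hy
  obtain ⟨k, hk1, hk2⟩ := exists_nat_pow_near ((one_le_div hR).2 hy) (one_lt_two (α := ℝ))
  rw [le_div_iff₀ hR] at hk1
  rw [div_lt_iff₀ hR, pow_succ] at hk2
  exact mem_iUnion.2 ⟨k, by linarith, by linarith⟩

end Dyadic

/-! ### Convolution with a bounded probability density -/

section Convolution

variable {E : Type*} [AddCommGroup E] [MeasurableSpace E] [MeasurableAdd₂ E] [MeasurableNeg E]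
  {μ : Measure E} [SFinite μ] [μ.IsAddLeftInvariant] [μ.IsNegInvariant] {K g : E → ℝ≥0∞}

/-- Jensen's inequality for the probability measure `K(x - y) dμ(y)`, in the form of monotonicity of
`L^q` norms in the exponent. -/
theorem lintegral_conv_rpow_le (hK : Measurable K) (hK1 : ∫⁻ y, K y ∂μ = 1)
    (hg : AEMeasurable g μ) {q : ℝ} (hq : 1 ≤ q) (x : E) :
    (∫⁻ y, K (x - y) * g y ∂μ) ^ q ≤ ∫⁻ y, K (x - y) * g y ^ q ∂μ := by
  have hKx : AEMeasurable (fun y => K (x - y)) μ :=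
    (hK.comp (measurable_const.sub measurable_id)).aemeasurable
  have : IsProbabilityMeasure (μ.withDensity fun y => K (x - y)) :=
    ⟨by rw [withDensity_apply _ MeasurableSet.univ, setLIntegral_univ, lintegral_sub_left_eq_self K x, hK1]⟩
  have hg' : AEMeasurable g (μ.withDensity fun y => K (x - y)) :=
    hg.mono_ac (withDensity_absolutelyContinuous _ _)
  have h := eLpNorm'_le_eLpNorm'_of_exponent_le one_pos hq (μ.withDensity fun y => K (x - y))
    hg'.aestronglyMeasurable
  simp only [eLpNorm'_eq_lintegral_enorm, enorm_eq_self, ENNReal.rpow_one, div_one] at h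
  rw [lintegral_withDensity_eq_lintegral_mul₀ hKx hg,
    lintegral_withDensity_eq_lintegral_mul₀ hKx (hg.pow_const q),
    one_div, ENNReal.le_rpow_inv_iff (by linarith)] at h
  exact h

theorem lintegral_conv_rpow_le_const_mul (hK : Measurable K) (hK1 : ∫⁻ y, K y ∂μ = 1)
    {A : ℝ≥0∞} (hA : ∀ x, K x ≤ A)
    (hg : AEMeasurable g μ) {q : ℝ} (hq : 1 ≤ q) (x : E) :
    (∫⁻ y, K (x - y) * g y ∂μ) ^ q ≤ A * ∫⁻ y, g y ^ q ∂μ := by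
  refine (lintegral_conv_rpow_le hK hK1 hg hq x).trans ?_
  rw [← lintegral_const_mul'' _ (hg.pow_const q)]
  gcongr
  exact hA _

theorem lintegral_lintegral_conv (hK : Measurable K) (hK1 : ∫⁻ y, K y ∂μ = 1)
    (hg : AEMeasurable g μ) : ∫⁻ x, ∫⁻ y, K (x - y) * g y ∂μ ∂μ = ∫⁻ y, g y ∂μ := by
  rw [lintegral_lintegral_swap]
  · refine lintegral_congr fun y => ?_
    have hKy : Measurable fun x => K (x - y) := hK.comp (measurable_id.sub_const y)
    rw [lintegral_mul_const _ hKy, lintegral_sub_right_eq_self K y, hK1, one_mul]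
  · exact (hK.comp (measurable_fst.sub measurable_snd)).aemeasurable.mul hg.comp_snd

/-- Young's convolution inequality for a bounded probability density. -/
theorem lintegral_conv_rpow_le_rpow (hK : Measurable K) (hK1 : ∫⁻ y, K y ∂μ = 1)
    {A : ℝ≥0∞} (hA : ∀ x, K x ≤ A)
    (hg : AEMeasurable g μ) {q s : ℝ} (hq : 1 ≤ q) (hqs : q ≤ s) :
    ∫⁻ x, (∫⁻ y, K (x - y) * g y ∂μ) ^ s ∂μ ≤
      A ^ (s / q - 1) * (∫⁻ y, g y ^ q ∂μ) ^ (s / q) := by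
  have hq0 : 0 < q := by linarith
  have hsq : 0 ≤ s / q - 1 := by rw [sub_nonneg, one_le_div hq0]; exact hqs
  have hmeas : AEMeasurable (fun x => ∫⁻ y, K (x - y) * g y ^ q ∂μ) μ :=
    ((hK.comp (measurable_fst.sub measurable_snd)).aemeasurable.mul
      (hg.pow_const q).comp_snd).lintegral_prod_right'
  calc ∫⁻ x, (∫⁻ y, K (x - y) * g y ∂μ) ^ s ∂μ
      ≤ ∫⁻ x, (A * ∫⁻ y, g y ^ q ∂μ) ^ (s / q - 1) * ∫⁻ y, K (x - y) * g y ^ q ∂μ ∂μ := by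
        refine lintegral_mono fun x => ?_
        -- Of the `s` powers, `s - q` are spent on the uniform bound and the remaining `q` on
        -- Jensen's bound, which Tonelli then integrates.
        have hs : s = q * (s / q - 1) + q := by field_simp; ring
        dsimp only
        conv_lhs => rw [hs]
        rw [ENNReal.rpow_add_of_nonneg _ _ (by positivity) hq0.le, ENNReal.rpow_mul]
        gcongr
        · exact lintegral_conv_rpow_le_const_mul hK hK1 hA hg hq x
        · exact lintegral_conv_rpow_le hK hK1 hg hq x
    _ = (A * ∫⁻ y, g y ^ q ∂μ) ^ (s / q - 1) * ∫⁻ y, g y ^ q ∂μ := by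
        rw [lintegral_const_mul'' _ hmeas, lintegral_lintegral_conv hK hK1 (hg.pow_const q)]
    _ = A ^ (s / q - 1) * (∫⁻ y, g y ^ q ∂μ) ^ (s / q) := by
        rw [ENNReal.mul_rpow_of_nonneg _ _ hsq, mul_assoc]
        congr 1
        conv_rhs => rw [← sub_add_cancel (s / q) 1]
        rw [ENNReal.rpow_add_of_nonneg _ _ hsq zero_le_one, ENNReal.rpow_one]

theorem eLpNorm_conv_le (hK : Measurable K) (hK1 : ∫⁻ y, K y ∂μ = 1)
    {A : ℝ≥0∞} (hA : ∀ x, K x ≤ A)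
    (hg : AEMeasurable g μ) {q s : ℝ} (hq : 1 ≤ q) (hqs : q ≤ s) :
    eLpNorm (fun x => ∫⁻ y, K (x - y) * g y ∂μ) (ENNReal.ofReal s) μ ≤
      A ^ (1 / q - 1 / s) * (∫⁻ y, g y ^ q ∂μ) ^ (1 / q) := by
  have hs0 : 0 < s := by linarith
  have hq0 : 0 < q := by linarith
  rw [eLpNorm_eq_lintegral_rpow_enorm_toReal (by simpa using hs0) ENNReal.ofReal_ne_top,
    ENNReal.toReal_ofReal hs0.le]
  simp only [enorm_eq_self]
  refine (ENNReal.rpow_le_rpow (lintegral_conv_rpow_le_rpow hK hK1 hA hg hq hqs)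
    (by positivity)).trans_eq ?_
  rw [ENNReal.mul_rpow_of_nonneg _ _ (by positivity), ← ENNReal.rpow_mul, ← ENNReal.rpow_mul]
  congr 2 <;> field_simp

end Convolution

/-! ### The Gauss kernel -/

section Gauss

variable {n : ℕ}

/-- The Gauss kernel `(4πt)^{-n/2} exp(-|x|²/(4t))`. -/
noncomputable def gaussKernel (t : ℝ) (x : EuclideanSpace ℝ (Fin n)) : ℝ :=
  1 / Real.sqrt ((4 * Real.pi * t) ^ n) * Real.exp (-(‖x‖ ^ 2 / (4 * t)))

theorem continuous_gaussKernel (t : ℝ) :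
    Continuous (gaussKernel t : EuclideanSpace ℝ (Fin n) → ℝ) := by
  unfold gaussKernel; fun_prop

theorem gaussKernel_nonneg (t : ℝ) (x : EuclideanSpace ℝ (Fin n)) : 0 ≤ gaussKernel t x := by
  unfold gaussKernel; positivity

theorem one_div_sqrt_pow {a : ℝ} (ha : 0 ≤ a) :
    1 / Real.sqrt (a ^ n) = a ^ (-((n : ℝ) / 2)) := by
  rw [Real.sqrt_eq_rpow, ← Real.rpow_natCast, ← Real.rpow_mul ha, Real.rpow_neg ha, one_div]
  congr 2; ring

theorem gaussKernel_le {t : ℝ} (ht : 0 < t) (x : EuclideanSpace ℝ (Fin n)) :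
    gaussKernel t x ≤ (4 * Real.pi * t) ^ (-((n : ℝ) / 2)) := by
  rw [← one_div_sqrt_pow (by positivity), gaussKernel]
  refine mul_le_of_le_one_right (by positivity) (Real.exp_le_one_iff.2 ?_)
  rw [neg_nonpos]; positivity

theorem lintegral_gaussKernel {t : ℝ} (ht : 0 < t) :
    ∫⁻ x : EuclideanSpace ℝ (Fin n), ENNReal.ofReal (gaussKernel t x) = 1 := by
  have hI : ∫ x : EuclideanSpace ℝ (Fin n), gaussKernel t x = 1 := by
    have h := GaussianFourier.integral_rexp_neg_mul_sq_norm (V := EuclideanSpace ℝ (Fin n))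
      (b := (4 * t)⁻¹) (by positivity)
    simp only [gaussKernel]
    rw [integral_const_mul, one_div_sqrt_pow (by positivity)]
    simp only [neg_mul, inv_mul_eq_div] at h
    rw [h, finrank_euclideanSpace_fin, div_inv_eq_mul,
      show Real.pi * (4 * t) = 4 * Real.pi * t by ring, ← Real.rpow_add (by positivity),
      neg_add_cancel, Real.rpow_zero]
  -- A nonintegrable function would have integral `0`, not `1`.
  have hint : Integrable (gaussKernel t : EuclideanSpace ℝ (Fin n) → ℝ) :=
    not_imp_comm.1 integral_undef (by rw [hI]; exact one_ne_zero)
  rw [← ofReal_integral_eq_lintegral_ofReal hint (Filter.Eventually.of_forall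
    (gaussKernel_nonneg t)), hI, ENNReal.ofReal_one]

variable {𝕜 : Type*} [RCLike 𝕜]

theorem enorm_heatSemigroup_le (t : ℝ) (w : EuclideanSpace ℝ (Fin n) → 𝕜)
    (x : EuclideanSpace ℝ (Fin n)) :
    ‖heatSemigroup t w x‖ₑ ≤ ∫⁻ y, ENNReal.ofReal (gaussKernel t (x - y)) * ‖w y‖ₑ := by
  unfold heatSemigroup
  rw [← integral_smul]
  refine (enorm_integral_le_lintegral_enorm _).trans (lintegral_mono fun y => le_of_eq ?_)
  rw [smul_smul, ← gaussKernel, enorm_smul, Real.enorm_of_nonneg (gaussKernel_nonneg _ _)]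

theorem aestronglyMeasurable_heatSemigroup (t : ℝ) {w : EuclideanSpace ℝ (Fin n) → 𝕜}
    (hw : AEStronglyMeasurable w volume) :
    AEStronglyMeasurable (heatSemigroup t w) volume := by
  unfold heatSemigroup
  refine AEStronglyMeasurable.const_smul (AEStronglyMeasurable.integral_prod_right'
    (f := fun z : EuclideanSpace ℝ (Fin n) × EuclideanSpace ℝ (Fin n) =>
      Real.exp (-(‖z.1 - z.2‖ ^ 2 / (4 * t))) • w z.2) ?_) _
  exact (Continuous.aestronglyMeasurable (by fun_prop)).smul hw.comp_snd

theorem integrable_exp_smul {t : ℝ} (ht : 0 < t) {w : EuclideanSpace ℝ (Fin n) → 𝕜}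
    (hw : AEStronglyMeasurable w volume) (x : EuclideanSpace ℝ (Fin n))
    (h : ∫⁻ y, ENNReal.ofReal (gaussKernel t (x - y)) * ‖w y‖ₑ < ∞) :
    Integrable (fun y => Real.exp (-(‖x - y‖ ^ 2 / (4 * t))) • w y) volume := by
  have hG : Integrable (fun y => gaussKernel t (x - y) • w y) volume := by
    refine ⟨(Continuous.aestronglyMeasurable
      ((continuous_gaussKernel t).comp (by fun_prop))).smul hw, ?_⟩
    refine lt_of_eq_of_lt (lintegral_congr fun y => ?_) h
    rw [enorm_smul, Real.enorm_of_nonneg (gaussKernel_nonneg _ _)]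
  have hc : 1 / Real.sqrt ((4 * Real.pi * t) ^ n) ≠ 0 := by positivity
  refine (hG.smul (1 / Real.sqrt ((4 * Real.pi * t) ^ n))⁻¹).congr
    (Filter.Eventually.of_forall fun y => ?_)
  simp only [Pi.smul_apply, gaussKernel, smul_smul, inv_mul_cancel_left₀ hc]

end Gauss

/-! ### The weighted function inside and outside a ball -/

section Morrey

variable {n : ℕ} {𝕜 : Type*} [RCLike 𝕜] {p q γ : ℝ} {f : EuclideanSpace ℝ (Fin n) → 𝕜}

theorem aestronglyMeasurable_weighted (γ : ℝ) (hf : AEStronglyMeasurable f volume) :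
    AEStronglyMeasurable (weighted γ f) volume :=
  (measurable_norm.pow_const (-γ)).aestronglyMeasurable.smul hf

theorem enorm_weighted (γ : ℝ) (f : EuclideanSpace ℝ (Fin n) → 𝕜)
    (y : EuclideanSpace ℝ (Fin n)) :
    ‖weighted γ f y‖ₑ = ENNReal.ofReal (‖y‖ ^ (-γ)) * ‖f y‖ₑ := by
  rw [weighted, enorm_smul, Real.enorm_of_nonneg (by positivity)]

theorem eLpNorm_ball_le_morreyNorm (x : EuclideanSpace ℝ (Fin n)) {r : ℝ} (hr : 0 < r) :
    eLpNorm f (ENNReal.ofReal q) (volume.restrict (Metric.ball x r)) ≤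
      morreyNorm p q f * ENNReal.ofReal (r ^ ((n : ℝ) / q - n / p)) := by
  have h : ENNReal.ofReal (r ^ ((n : ℝ) / p - n / q)) *
      eLpNorm f (ENNReal.ofReal q) (volume.restrict (Metric.ball x r)) ≤ morreyNorm p q f :=
    le_iSup_of_le x (le_iSup₂_of_le r hr le_rfl)
  refine le_trans (le_of_eq ?_) (mul_le_mul_left h _)
  rw [mul_right_comm, ← ENNReal.ofReal_mul (by positivity), ← Real.rpow_add hr]
  simp

theorem setLIntegral_ball_enorm_rpow_le (hq : 0 < q) (x : EuclideanSpace ℝ (Fin n)) {r : ℝ}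
    (hr : 0 < r) :
    ∫⁻ y in Metric.ball x r, ‖f y‖ₑ ^ q ≤
      morreyNorm p q f ^ q * ENNReal.ofReal (r ^ (((n : ℝ) / q - n / p) * q)) := by
  have h := eLpNorm_ball_le_morreyNorm (f := f) (p := p) (q := q) x hr
  rw [eLpNorm_eq_lintegral_rpow_enorm_toReal (by simpa using hq) ENNReal.ofReal_ne_top,
    ENNReal.toReal_ofReal hq.le, one_div, ENNReal.rpow_inv_le_iff hq] at h
  rwa [ENNReal.mul_rpow_of_nonneg _ _ hq.le,
    ENNReal.ofReal_rpow_of_nonneg (by positivity) hq.le, ← Real.rpow_mul hr.le] at h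

/-- Hölder on the ball: the factor `|B(x,r)|^{1-1/q}` raises the exponent from `n/q - n/p` to `n -
n/p`. -/
theorem setLIntegral_ball_enorm_le [Nonempty (Fin n)] (hq : 1 ≤ q)
    (hf : AEStronglyMeasurable f volume) (x : EuclideanSpace ℝ (Fin n)) {r : ℝ} (hr : 0 < r) :
    ∫⁻ y in Metric.ball x r, ‖f y‖ₑ ≤
      morreyNorm p q f *
        volume (Metric.ball (0 : EuclideanSpace ℝ (Fin n)) 1) ^ (1 - 1 / q) *
        ENNReal.ofReal (r ^ ((n : ℝ) - n / p)) := by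
  have hq0 : 0 < q := by linarith
  have hq1 : 0 ≤ 1 - 1 / q := by rw [sub_nonneg, div_le_one hq0]; exact hq
  rw [← eLpNorm_one_eq_lintegral_enorm]
  refine (eLpNorm_le_eLpNorm_mul_rpow_measure_univ (q := ENNReal.ofReal q)
    (by rw [← ENNReal.ofReal_one]; exact ENNReal.ofReal_le_ofReal hq) hf.restrict).trans ?_
  rw [Measure.restrict_apply_univ, Measure.addHaar_ball _ _ hr.le, finrank_euclideanSpace_fin,
    ENNReal.toReal_one, ENNReal.toReal_ofReal hq0.le, div_one,
    ENNReal.mul_rpow_of_nonneg _ _ hq1, ENNReal.ofReal_rpow_of_nonneg (by positivity) hq1]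
  refine (mul_le_mul_left (eLpNorm_ball_le_morreyNorm (p := p) x hr) _).trans_eq ?_
  have : (r ^ ((n : ℝ) - n / p)) =
      r ^ ((n : ℝ) / q - n / p) * (r ^ n) ^ (1 - 1 / q) := by
    rw [← Real.rpow_natCast, ← Real.rpow_mul hr.le, ← Real.rpow_add hr]
    congr 1; ring
  rw [this, ENNReal.ofReal_mul (by positivity)]
  ring

theorem exists_setLIntegral_ball_weighted_le (hn : 1 ≤ n) (hq : 1 ≤ q) (hγ : 0 < γ)
    (hγn : γ < (n : ℝ) - n / p) :
    ∃ C : ℝ, 0 ≤ C ∧ ∀ f : EuclideanSpace ℝ (Fin n) → 𝕜, AEStronglyMeasurable f volume →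
      ∀ R : ℝ, 0 < R → ∫⁻ y in Metric.ball 0 R, ‖weighted γ f y‖ₑ ≤
        morreyNorm p q f * ENNReal.ofReal (C * R ^ ((n : ℝ) - n / p - γ)) := by
  have : Nonempty (Fin n) := ⟨⟨0, hn⟩⟩
  have hq1 : 0 ≤ 1 - 1 / q := by rw [sub_nonneg, div_le_one (by linarith)]; exact hq
  set V := volume (Metric.ball (0 : EuclideanSpace ℝ (Fin n)) 1) ^ (1 - 1 / q)
  have hV : V ≠ ∞ := ENNReal.rpow_ne_top_of_nonneg hq1 measure_ball_lt_top.ne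
  have h1 : 0 ≤ (1 - (1 / 2 : ℝ) ^ ((n : ℝ) - n / p - γ))⁻¹ :=
    inv_nonneg.2 (sub_nonneg.2 (Real.rpow_le_one (by norm_num) (by norm_num) (by linarith)))
  refine ⟨V.toReal * (4 ^ ((n : ℝ) - n / p) * (1 - (1 / 2) ^ ((n : ℝ) - n / p - γ))⁻¹),
    by positivity, fun f hf R hR => ?_⟩
  simp only [enorm_weighted]
  refine (setLIntegral_ball_rpow_mul_le hγ hγn hR fun r hr =>
    setLIntegral_ball_enorm_le hq hf 0 hr).trans_eq ?_
  rw [mul_assoc V.toReal, ENNReal.ofReal_mul ENNReal.toReal_nonneg, ENNReal.ofReal_toReal hV,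
    mul_assoc]

/-- The dyadic bound at infinity applied to `|f|^q`, with growth exponent `(n/q - n/p)q` and weight
exponent `γq`. -/
theorem exists_setLIntegral_compl_ball_weighted_le (hq : 0 < q) (hγ : 0 < γ)
    (hγn : (n : ℝ) / q - n / p < γ) :
    ∃ C : ℝ, 0 ≤ C ∧ ∀ f : EuclideanSpace ℝ (Fin n) → 𝕜,
      ∀ R : ℝ, 0 < R → (∫⁻ y in (Metric.ball 0 R)ᶜ, ‖weighted γ f y‖ₑ ^ q) ^ (1 / q) ≤
        morreyNorm p q f * ENNReal.ofReal (C * R ^ ((n : ℝ) / q - n / p - γ)) := by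
  set a := ((n : ℝ) / q - n / p) * q
  have ha : a - γ * q = ((n : ℝ) / q - n / p - γ) * q := by ring
  have ha0 : a < γ * q := mul_lt_mul_of_pos_right hγn hq
  have h1 : 0 ≤ (1 - (2 : ℝ) ^ (a - γ * q))⁻¹ :=
    inv_nonneg.2 (sub_nonneg.2 (Real.rpow_le_one_of_one_le_of_nonpos (by norm_num)
      (by linarith)))
  refine ⟨(4 ^ a * (1 - 2 ^ (a - γ * q))⁻¹) ^ (1 / q), by positivity, fun f R hR => ?_⟩
  have hw : ∀ y, ‖weighted γ f y‖ₑ ^ q = ENNReal.ofReal (‖y‖ ^ (-(γ * q))) * ‖f y‖ₑ ^ q := by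
    intro y
    rw [enorm_weighted, ENNReal.mul_rpow_of_nonneg _ _ hq.le,
      ENNReal.ofReal_rpow_of_nonneg (by positivity) hq.le, ← Real.rpow_mul (norm_nonneg _),
      neg_mul]
  simp only [hw]
  rw [one_div, ENNReal.rpow_inv_le_iff hq]
  refine (setLIntegral_compl_ball_rpow_mul_le (by positivity) ha0 hR fun r hr =>
    setLIntegral_ball_enorm_rpow_le (p := p) hq 0 hr).trans_eq ?_
  rw [ENNReal.mul_rpow_of_nonneg _ _ hq.le,
    ENNReal.ofReal_rpow_of_nonneg (by positivity) hq.le,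
    Real.mul_rpow (by positivity) (by positivity), ← Real.rpow_mul (by positivity),
    inv_mul_cancel₀ hq.ne', Real.rpow_one, ← Real.rpow_mul hR.le, ha]

end Morrey

/-! ### Smoothing estimates for the heat semigroup -/

section HeatEstimate

variable {n : ℕ} {p q s γ t : ℝ} {g : EuclideanSpace ℝ (Fin n) → ℝ≥0∞}

theorem measurable_ofReal_gaussKernel (t : ℝ) :
    Measurable fun x : EuclideanSpace ℝ (Fin n) => ENNReal.ofReal (gaussKernel t x) :=
  (continuous_gaussKernel t).measurable.ennreal_ofReal

theorem lintegral_gaussKernel_mul_lt_top (ht : 0 < t) (hg : AEMeasurable g volume)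
    (hq : 1 ≤ q) (h : (∫⁻ y, g y ^ q) ^ (1 / q) < ∞) (x : EuclideanSpace ℝ (Fin n)) :
    ∫⁻ y, ENNReal.ofReal (gaussKernel t (x - y)) * g y < ∞ := by
  have hq0 : 0 < q := by linarith
  rw [ENNReal.rpow_lt_top_iff_of_pos (by positivity)] at h
  rw [← ENNReal.rpow_lt_top_iff_of_pos hq0]
  exact (lintegral_conv_rpow_le_const_mul (measurable_ofReal_gaussKernel t)
    (lintegral_gaussKernel ht) (fun x => ENNReal.ofReal_le_ofReal (gaussKernel_le ht x))
    hg hq x).trans_lt (ENNReal.mul_lt_top ENNReal.ofReal_lt_top h)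

/-- The exponent `q` cancels from the final power of `t`, so the `L¹` piece (taken with `q = 1`) and
the `L^q` piece can be added. -/
theorem eLpNorm_gaussKernel_conv_le (ht : 0 < t) (hg : AEMeasurable g volume)
    (hq : 1 ≤ q) (hqs : q ≤ s) {N : ℝ≥0∞} {C : ℝ}
    (h : (∫⁻ y, g y ^ q) ^ (1 / q) ≤
      N * ENNReal.ofReal (C * Real.sqrt t ^ ((n : ℝ) / q - n / p - γ))) :
    eLpNorm (fun x => ∫⁻ y, ENNReal.ofReal (gaussKernel t (x - y)) * g y)
      (ENNReal.ofReal s) volume ≤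
      N * ENNReal.ofReal ((4 * Real.pi) ^ (-((n : ℝ) / 2) * (1 / q - 1 / s)) * C *
        t ^ (-((n : ℝ) / 2) * (1 / p - 1 / s) - γ / 2)) := by
  have hθ : 0 ≤ 1 / q - 1 / s :=
    sub_nonneg.2 (one_div_le_one_div_of_le (by linarith) hqs)
  refine (eLpNorm_conv_le (measurable_ofReal_gaussKernel t) (lintegral_gaussKernel ht)
    (fun x => ENNReal.ofReal_le_ofReal (gaussKernel_le ht x)) hg hq hqs).trans ?_
  refine (mul_le_mul_right h _).trans_eq ?_
  rw [ENNReal.ofReal_rpow_of_nonneg (by positivity) hθ, mul_left_comm,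
    ← ENNReal.ofReal_mul (by positivity), ← Real.rpow_mul (by positivity),
    Real.mul_rpow (by positivity) ht.le, Real.sqrt_eq_rpow, ← Real.rpow_mul ht.le,
    show -((n : ℝ) / 2) * (1 / p - 1 / s) - γ / 2 =
      -((n : ℝ) / 2) * (1 / q - 1 / s) + 1 / 2 * ((n : ℝ) / q - n / p - γ) by ring,
    Real.rpow_add ht]
  congr 2; ring

variable {𝕜 : Type*} [RCLike 𝕜]

theorem enorm_eq_indicator_add (w : EuclideanSpace ℝ (Fin n) → 𝕜)
    (S : Set (EuclideanSpace ℝ (Fin n))) (y : EuclideanSpace ℝ (Fin n)) :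
    ‖w y‖ₑ = S.indicator (fun y => ‖w y‖ₑ) y + Sᶜ.indicator (fun y => ‖w y‖ₑ) y :=
  (congrFun (indicator_self_add_compl S fun y => ‖w y‖ₑ) y).symm

theorem lintegral_indicator_rpow {S : Set (EuclideanSpace ℝ (Fin n))} (hS : MeasurableSet S)
    (hq : 0 < q) : ∫⁻ y, S.indicator g y ^ q = ∫⁻ y in S, g y ^ q := by
  rw [← lintegral_indicator hS]
  refine lintegral_congr fun y => ?_
  by_cases hy : y ∈ S <;> simp [hy, hq]

/-- `|x|^{-γ} f` splits at radius `√t` into a part in `L¹` and a part in `L^q`; both parts are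
mapped to `L^s` by the heat semigroup with the same power of `t`. -/
theorem exists_weighted_splitting (hn : 1 ≤ n) (hq : 1 < q) (hγ : 0 < γ)
    (hγ_lower : (n : ℝ) / q - (n : ℝ) / p < γ) (hγ_upper : γ < (n : ℝ) - (n : ℝ) / p) :
    ∃ C₁ C₂ : ℝ, 0 ≤ C₁ ∧ 0 ≤ C₂ ∧ ∀ t : ℝ, 0 < t →
      ∀ f : EuclideanSpace ℝ (Fin n) → 𝕜, AEStronglyMeasurable f volume →
      ∃ g₁ g₂ : EuclideanSpace ℝ (Fin n) → ℝ≥0∞, AEMeasurable g₁ volume ∧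
        AEMeasurable g₂ volume ∧ (∀ y, ‖weighted γ f y‖ₑ = g₁ y + g₂ y) ∧
        (∫⁻ y, g₁ y ^ (1 : ℝ)) ^ (1 / (1 : ℝ)) ≤ morreyNorm p q f *
          ENNReal.ofReal (C₁ * Real.sqrt t ^ ((n : ℝ) / (1 : ℝ) - n / p - γ)) ∧
        (∫⁻ y, g₂ y ^ q) ^ (1 / q) ≤ morreyNorm p q f *
          ENNReal.ofReal (C₂ * Real.sqrt t ^ ((n : ℝ) / q - n / p - γ)) := by
  obtain ⟨C₁, hC₁, h₁⟩ := exists_setLIntegral_ball_weighted_le (𝕜 := 𝕜) hn hq.le hγ hγ_upper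
  obtain ⟨C₂, hC₂, h₂⟩ :=
    exists_setLIntegral_compl_ball_weighted_le (𝕜 := 𝕜) (by linarith : 0 < q) hγ hγ_lower
  refine ⟨C₁, C₂, hC₁, hC₂, fun t ht f hf => ?_⟩
  have hB : MeasurableSet (Metric.ball (0 : EuclideanSpace ℝ (Fin n)) (Real.sqrt t)) :=
    Metric.isOpen_ball.measurableSet
  have hw := (aestronglyMeasurable_weighted γ hf).enorm
  refine ⟨_, _, hw.indicator hB, hw.indicator hB.compl, enorm_eq_indicator_add _ _, ?_, ?_⟩
  · rw [lintegral_indicator_rpow hB one_pos, div_one, div_one]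
    simpa only [ENNReal.rpow_one] using h₁ f hf _ (Real.sqrt_pos.2 ht)
  · rw [lintegral_indicator_rpow hB.compl (by linarith)]
    exact h₂ f _ (Real.sqrt_pos.2 ht)

theorem lintegral_gaussKernel_mul_add {g₁ g₂ : EuclideanSpace ℝ (Fin n) → ℝ≥0∞}
    (hg₁ : AEMeasurable g₁ volume) (x : EuclideanSpace ℝ (Fin n)) :
    ∫⁻ y, ENNReal.ofReal (gaussKernel t (x - y)) * (g₁ y + g₂ y) =
      (∫⁻ y, ENNReal.ofReal (gaussKernel t (x - y)) * g₁ y) +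
        ∫⁻ y, ENNReal.ofReal (gaussKernel t (x - y)) * g₂ y := by
  simp only [mul_add]
  exact lintegral_add_left' (((measurable_ofReal_gaussKernel t).comp
    (measurable_const.sub measurable_id)).aemeasurable.mul hg₁) _

theorem integrable_exp_smul_weighted (hn : 1 ≤ n) (hq : 1 < q) (hγ : 0 < γ)
    (hγ_lower : (n : ℝ) / q - (n : ℝ) / p < γ) (hγ_upper : γ < (n : ℝ) - (n : ℝ) / p)
    (ht : 0 < t) {f : EuclideanSpace ℝ (Fin n) → 𝕜} (hf : MemMorrey p q f)
    (x : EuclideanSpace ℝ (Fin n)) :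
    Integrable (fun y : EuclideanSpace ℝ (Fin n) =>
      Real.exp (-(‖x - y‖ ^ 2 / (4 * t))) • weighted γ f y) volume := by
  obtain ⟨C₁, C₂, -, -, h⟩ :=
    exists_weighted_splitting (𝕜 := 𝕜) hn hq hγ hγ_lower hγ_upper
  obtain ⟨g₁, g₂, hg₁, hg₂, hw, h₁, h₂⟩ := h t ht f hf.1
  refine integrable_exp_smul ht (aestronglyMeasurable_weighted γ hf.1) x ?_
  simp only [hw]
  rw [lintegral_gaussKernel_mul_add hg₁]
  exact ENNReal.add_lt_top.2
    ⟨lintegral_gaussKernel_mul_lt_top ht hg₁ le_rfl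
      (h₁.trans_lt (ENNReal.mul_lt_top hf.2 ENNReal.ofReal_lt_top)) x,
    lintegral_gaussKernel_mul_lt_top ht hg₂ hq.le
      (h₂.trans_lt (ENNReal.mul_lt_top hf.2 ENNReal.ofReal_lt_top)) x⟩

theorem aemeasurable_gaussKernel_conv (t : ℝ) (hg : AEMeasurable g volume) :
    AEMeasurable (fun x => ∫⁻ y, ENNReal.ofReal (gaussKernel t (x - y)) * g y) volume :=
  (((measurable_ofReal_gaussKernel t).comp
    (measurable_fst.sub measurable_snd)).aemeasurable.mul hg.comp_snd).lintegral_prod_right'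

/-- The strong type estimate holds for all `q ≤ s`. -/
theorem exists_eLpNorm_heatSemigroup_weighted_le (hn : 1 ≤ n) (hq : 1 < q) (hγ : 0 < γ)
    (hγ_lower : (n : ℝ) / q - (n : ℝ) / p < γ) (hγ_upper : γ < (n : ℝ) - (n : ℝ) / p)
    (hqs : q ≤ s) :
    ∃ C : ℝ, 0 < C ∧ ∀ t : ℝ, 0 < t →
      ∀ f : EuclideanSpace ℝ (Fin n) → 𝕜, MemMorrey p q f →
        MemLp (heatSemigroup t (weighted γ f)) (ENNReal.ofReal s) volume ∧
        eLpNorm (heatSemigroup t (weighted γ f)) (ENNReal.ofReal s) volume ≤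
          ENNReal.ofReal (C * t ^ (-((n : ℝ) / 2) * (1 / p - 1 / s) - γ / 2)) *
            morreyNorm p q f := by
  obtain ⟨C₁, C₂, hC₁, hC₂, h⟩ :=
    exists_weighted_splitting (𝕜 := 𝕜) hn hq hγ hγ_lower hγ_upper
  set D₁ := (4 * Real.pi) ^ (-((n : ℝ) / 2) * (1 / 1 - 1 / s)) * C₁
  set D₂ := (4 * Real.pi) ^ (-((n : ℝ) / 2) * (1 / q - 1 / s)) * C₂
  have hD₁ : 0 ≤ D₁ := by positivity
  have hD₂ : 0 ≤ D₂ := by positivity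
  -- The summand `1` only makes the constant strictly positive.
  refine ⟨D₁ + D₂ + 1, by positivity, fun t ht f hf => ?_⟩
  obtain ⟨g₁, g₂, hg₁, hg₂, hw, h₁, h₂⟩ := h t ht f hf.1
  have hle : eLpNorm (heatSemigroup t (weighted γ f)) (ENNReal.ofReal s) volume ≤
      ENNReal.ofReal ((D₁ + D₂ + 1) * t ^ (-((n : ℝ) / 2) * (1 / p - 1 / s) - γ / 2)) *
        morreyNorm p q f := by
    have hs1 : (1 : ℝ≥0∞) ≤ ENNReal.ofReal s := by
      rw [← ENNReal.ofReal_one]; exact ENNReal.ofReal_le_ofReal (by linarith)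
    calc eLpNorm (heatSemigroup t (weighted γ f)) (ENNReal.ofReal s) volume
        ≤ eLpNorm ((fun x => ∫⁻ y, ENNReal.ofReal (gaussKernel t (x - y)) * g₁ y) +
            fun x => ∫⁻ y, ENNReal.ofReal (gaussKernel t (x - y)) * g₂ y)
            (ENNReal.ofReal s) volume := by
          refine eLpNorm_mono_enorm fun x => (enorm_heatSemigroup_le t _ x).trans_eq ?_
          simp only [hw]
          exact lintegral_gaussKernel_mul_add hg₁ x
      _ ≤ _ := eLpNorm_add_le (aemeasurable_gaussKernel_conv t hg₁).aestronglyMeasurable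
          (aemeasurable_gaussKernel_conv t hg₂).aestronglyMeasurable hs1
      _ ≤ _ := add_le_add (eLpNorm_gaussKernel_conv_le ht hg₁ le_rfl (by linarith) h₁)
          (eLpNorm_gaussKernel_conv_le ht hg₂ hq.le hqs h₂)
      _ ≤ _ := by
          rw [← mul_add, ← ENNReal.ofReal_add (by positivity) (by positivity), ← add_mul,
            mul_comm (morreyNorm p q f)]
          exact mul_le_mul_left (ENNReal.ofReal_le_ofReal (mul_le_mul_of_nonneg_right
            (le_add_of_nonneg_right zero_le_one) (by positivity))) _
  exact ⟨⟨aestronglyMeasurable_heatSemigroup t (aestronglyMeasurable_weighted γ hf.1),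
    hle.trans_lt (ENNReal.mul_lt_top ENNReal.ofReal_lt_top hf.2)⟩, hle⟩

/-- Chebyshev: `t χ_{|f|>t} ≤ |f|` pointwise. -/
theorem weakLpNorm_le_eLpNorm (p : ℝ) (f : EuclideanSpace ℝ (Fin n) → 𝕜) :
    weakLpNorm p f ≤ eLpNorm f (ENNReal.ofReal p) volume := by
  refine iSup₂_le fun t ht => ?_
  have : ENNReal.ofReal t = ‖t‖ₑ := (Real.enorm_of_nonneg ht.le).symm
  rw [this, ← eLpNorm_const_smul]
  refine eLpNorm_mono fun x => ?_
  by_cases hx : t < ‖f x‖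
  · simpa [hx, abs_of_pos ht] using hx.le
  · simp [hx]

end HeatEstimate

/-! ### Embedding of weak Lebesgue spaces into Morrey spaces -/

section WeakLp

variable {n : ℕ} {𝕜 : Type*} [RCLike 𝕜] {p q : ℝ} {f : EuclideanSpace ℝ (Fin n) → 𝕜}

theorem nullMeasurableSet_lt_norm (hf : AEStronglyMeasurable f volume) (t : ℝ) :
    NullMeasurableSet {x | t < ‖f x‖} volume :=
  nullMeasurableSet_lt aemeasurable_const hf.norm.aemeasurable

theorem ofReal_mul_meas_rpow_le_weakLpNorm (hp : 0 < p) (hf : AEStronglyMeasurable f volume)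
    {t : ℝ} (ht : 0 < t) :
    ENNReal.ofReal t * volume {x | t < ‖f x‖} ^ (1 / p) ≤ weakLpNorm p f := by
  have h := le_iSup₂ (f := fun (t : ℝ) (_ : 0 < t) => ENNReal.ofReal t *
    eLpNorm ({x | t < ‖f x‖}.indicator (fun _ => (1 : ℝ))) (ENNReal.ofReal p) volume) t ht
  rw [eLpNorm_indicator_const₀ (nullMeasurableSet_lt_norm hf t) (by simpa using hp)
    ENNReal.ofReal_ne_top, ENNReal.toReal_ofReal hp.le, enorm_one, one_mul] at h
  exact h

theorem meas_lt_norm_le (hp : 0 < p) (hf : AEStronglyMeasurable f volume) {t : ℝ} (ht : 0 < t) :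
    volume {x | t < ‖f x‖} ≤ weakLpNorm p f ^ p * ENNReal.ofReal (t ^ (-p)) := by
  have h := ENNReal.rpow_le_rpow (ofReal_mul_meas_rpow_le_weakLpNorm hp hf ht) hp.le
  rw [ENNReal.mul_rpow_of_nonneg _ _ hp.le, ← ENNReal.rpow_mul, one_div_mul_cancel hp.ne',
    ENNReal.rpow_one, ENNReal.ofReal_rpow_of_nonneg ht.le hp.le] at h
  refine le_trans (le_of_eq ?_) (mul_le_mul_left h _)
  rw [mul_right_comm, ← ENNReal.ofReal_mul (by positivity), ← Real.rpow_add ht]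
  simp

/-- If `2^k l ≤ ‖a‖ < 2^{k+1} l`, the `k`-th term alone suffices. The threshold uses `l / 2` so that
the inequality is strict, as in the superlevel sets of the weak norm. -/
theorem enorm_rpow_le_tsum {a : 𝕜} (hq : 0 ≤ q) {l : ℝ} (hl : 0 < l) :
    ‖a‖ₑ ^ q ≤ ENNReal.ofReal (l ^ q) + ∑' k : ℕ,
      if 2 ^ k * (l / 2) < ‖a‖ then ENNReal.ofReal ((2 ^ k * (2 * l)) ^ q) else 0 := by
  rw [← ofReal_norm, ENNReal.ofReal_rpow_of_nonneg (norm_nonneg a) hq]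
  rcases le_total ‖a‖ l with h | h
  · exact le_add_right (ENNReal.ofReal_le_ofReal (by gcongr))
  · obtain ⟨k, hk1, hk2⟩ := exists_nat_pow_near ((one_le_div hl).2 h) (one_lt_two (α := ℝ))
    rw [le_div_iff₀ hl] at hk1
    rw [div_lt_iff₀ hl, pow_succ] at hk2
    have : (0 : ℝ) < 2 ^ k * l := by positivity
    refine le_add_left (le_trans ?_ (ENNReal.le_tsum k))
    rw [if_pos (by linarith)]
    exact ENNReal.ofReal_le_ofReal (Real.rpow_le_rpow (norm_nonneg a) (by linarith) hq)

/-- Values up to `l` are bounded trivially. Above `l`, the `k`-th dyadic level contributes height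
`(2^{k+1} l)^q` times measure `O((2^k l)^{-p})`, a geometric series since `q < p`. -/
theorem setLIntegral_enorm_rpow_le_weakLpNorm (hq : 0 < q) (hqp : q < p)
    (hf : AEStronglyMeasurable f volume) (S : Set (EuclideanSpace ℝ (Fin n))) {l : ℝ}
    (hl : 0 < l) :
    ∫⁻ y in S, ‖f y‖ₑ ^ q ≤ ENNReal.ofReal (l ^ q) * volume S +
      weakLpNorm p f ^ p *
        ENNReal.ofReal (2 ^ q * 2 ^ p * (1 - 2 ^ (q - p))⁻¹ * l ^ (q - p)) := by
  have hpow : (2 : ℝ) ^ (q - p) < 1 :=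
    Real.rpow_lt_one_of_one_lt_of_neg one_lt_two (by linarith)
  have hpow0 : (0 : ℝ) < 2 ^ (q - p) := by positivity
  let c : ℕ → ℝ≥0∞ := fun k => ENNReal.ofReal ((2 ^ k * (2 * l)) ^ q)
  have hterm : ∀ k : ℕ, ∫⁻ y in S, {x | 2 ^ k * (l / 2) < ‖f x‖}.indicator (fun _ => c k) y ≤
      weakLpNorm p f ^ p *
        ENNReal.ofReal (2 ^ q * 2 ^ p * l ^ (q - p) * ((2 : ℝ) ^ (q - p)) ^ k) := by
    intro k
    refine (setLIntegral_le_lintegral _ _).trans ?_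
    rw [lintegral_indicator_const₀ (nullMeasurableSet_lt_norm hf _)]
    refine (mul_le_mul_right (meas_lt_norm_le (hq.trans hqp) hf (by positivity)) _).trans_eq ?_
    rw [mul_left_comm, ← ENNReal.ofReal_mul (by positivity)]
    congr 2
    have h2 : (0 : ℝ) < 2 ^ k := by positivity
    rw [Real.mul_rpow h2.le (by positivity), Real.mul_rpow two_pos.le hl.le,
      Real.mul_rpow h2.le (by positivity), Real.div_rpow hl.le two_pos.le,
      Real.rpow_neg two_pos.le p, ← Real.rpow_natCast (2 ^ (q - p)) k,
      ← Real.rpow_mul two_pos.le, mul_comm (q - p), Real.rpow_mul two_pos.le, Real.rpow_natCast,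
      sub_eq_add_neg, Real.rpow_add hl, Real.rpow_add h2, div_inv_eq_mul]
    ring
  have hs : Summable fun k : ℕ => 2 ^ q * 2 ^ p * l ^ (q - p) * ((2 : ℝ) ^ (q - p)) ^ k :=
    (summable_geometric_of_lt_one hpow0.le hpow).mul_left _
  calc ∫⁻ y in S, ‖f y‖ₑ ^ q
      ≤ ∫⁻ y in S, (ENNReal.ofReal (l ^ q) +
          ∑' k : ℕ, {x | 2 ^ k * (l / 2) < ‖f x‖}.indicator (fun _ => c k) y) := by
        refine lintegral_mono fun y => (enorm_rpow_le_tsum hq.le hl).trans_eq ?_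
        simp only [indicator_apply, mem_ofPred_eq, c]
    _ = ENNReal.ofReal (l ^ q) * volume S + ∑' k : ℕ, ∫⁻ y in S,
          {x | 2 ^ k * (l / 2) < ‖f x‖}.indicator (fun _ => c k) y := by
        rw [lintegral_add_left measurable_const, setLIntegral_const, lintegral_tsum]
        exact fun k => ((aemeasurable_const).indicator₀
          (nullMeasurableSet_lt_norm hf _)).restrict
    _ ≤ ENNReal.ofReal (l ^ q) * volume S + ∑' k : ℕ, weakLpNorm p f ^ p *
          ENNReal.ofReal (2 ^ q * 2 ^ p * l ^ (q - p) * ((2 : ℝ) ^ (q - p)) ^ k) := by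
        gcongr with k
        exact hterm k
    _ = _ := by
        rw [ENNReal.tsum_mul_left, ← ENNReal.ofReal_tsum_of_nonneg (fun k => by positivity) hs,
          tsum_mul_left, tsum_geometric_of_lt_one hpow0.le hpow]
        congr 3; ring

theorem exists_morreyNorm_le_weakLpNorm [Nonempty (Fin n)] (hq : 0 < q) (hqp : q < p) :
    ∃ C : ℝ, 0 < C ∧ ∀ f : EuclideanSpace ℝ (Fin n) → 𝕜, MemWeakLp p f →
      MemMorrey p q f ∧ morreyNorm p q f ≤ ENNReal.ofReal C * weakLpNorm p f := by
  have hp : 0 < p := hq.trans hqp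
  set V := (volume (Metric.ball (0 : EuclideanSpace ℝ (Fin n)) 1)).toReal
  have hV : ENNReal.ofReal V = volume (Metric.ball (0 : EuclideanSpace ℝ (Fin n)) 1) :=
    ENNReal.ofReal_toReal measure_ball_lt_top.ne
  have hV0 : 0 ≤ V := ENNReal.toReal_nonneg
  set D : ℝ := 2 ^ q * 2 ^ p * (1 - 2 ^ (q - p))⁻¹ with hD
  have hD0 : 0 < D := by
    have : (2 : ℝ) ^ (q - p) < 1 := Real.rpow_lt_one_of_one_lt_of_neg one_lt_two (by linarith)
    have : 0 < (1 - (2 : ℝ) ^ (q - p))⁻¹ := inv_pos.2 (by linarith)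
    positivity
  refine ⟨(V + D) ^ (1 / q), by positivity, fun f hf => ?_⟩
  -- A strict majorant `N` of the weak norm stays positive even if that norm is zero, so it can
  -- define a level; at the end `N` decreases to the norm.
  have key : ∀ N : ℝ, (weakLpNorm p f).toReal < N →
      morreyNorm p q f ≤ ENNReal.ofReal ((V + D) ^ (1 / q) * N) := by
    intro N hN
    have hN0 : 0 < N := ENNReal.toReal_nonneg.trans_lt hN
    refine iSup_le fun x => iSup₂_le fun r hr => ?_
    have hint : ∫⁻ y in Metric.ball x r, ‖f y‖ₑ ^ q ≤
        ENNReal.ofReal ((V + D) * (N * r ^ ((n : ℝ) / q - n / p)) ^ q) := by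
      -- This level balances the two terms: `l^q r^n` and `N^p l^{q-p}` both equal `(N
      -- r^{n/q-n/p})^q`.
      have hl : 0 < N * r ^ (-((n : ℝ) / p)) := by positivity
      refine (setLIntegral_enorm_rpow_le_weakLpNorm hq hqp hf.1 _ hl).trans ?_
      have hNw : weakLpNorm p f ^ p ≤ ENNReal.ofReal (N ^ p) := by
        rw [← ENNReal.ofReal_rpow_of_nonneg hN0.le hp.le]
        gcongr
        rw [← ENNReal.ofReal_toReal hf.2.ne]
        exact ENNReal.ofReal_le_ofReal hN.le
      refine (add_le_add_right (mul_le_mul_left hNw _) _).trans_eq ?_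
      rw [Measure.addHaar_ball _ _ hr.le, finrank_euclideanSpace_fin, ← hV, ← hD,
        ← ENNReal.ofReal_mul (by positivity), ← ENNReal.ofReal_mul (by positivity),
        ← ENNReal.ofReal_mul (by positivity), ← ENNReal.ofReal_add (by positivity)
          (by positivity), add_mul]
      have e1 : (N * r ^ (-((n : ℝ) / p))) ^ q * r ^ n =
          (N * r ^ ((n : ℝ) / q - n / p)) ^ q := by
        rw [Real.mul_rpow hN0.le (by positivity), Real.mul_rpow hN0.le (by positivity),
          ← Real.rpow_mul hr.le, ← Real.rpow_mul hr.le, ← Real.rpow_natCast, mul_assoc,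
          ← Real.rpow_add hr]
        congr 2; field_simp; ring
      have e2 : N ^ p * (N * r ^ (-((n : ℝ) / p))) ^ (q - p) =
          (N * r ^ ((n : ℝ) / q - n / p)) ^ q := by
        rw [Real.mul_rpow hN0.le (by positivity), Real.mul_rpow hN0.le (by positivity),
          ← Real.rpow_mul hr.le, ← Real.rpow_mul hr.le, ← mul_assoc, ← Real.rpow_add hN0]
        congr 2
        · ring
        · field_simp; ring
      congr 1
      rw [← mul_assoc, e1, mul_left_comm, e2]
      ring
    rw [eLpNorm_eq_lintegral_rpow_enorm_toReal (by simpa using hq) ENNReal.ofReal_ne_top,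
      ENNReal.toReal_ofReal hq.le]
    refine (mul_le_mul_right (ENNReal.rpow_le_rpow hint (by positivity)) _).trans_eq ?_
    rw [ENNReal.ofReal_rpow_of_nonneg (by positivity) (by positivity),
      ← ENNReal.ofReal_mul (by positivity), Real.mul_rpow (by positivity) (by positivity),
      ← Real.rpow_mul (by positivity), mul_one_div_cancel hq.ne', Real.rpow_one]
    have : r ^ ((n : ℝ) / p - n / q) * r ^ ((n : ℝ) / q - n / p) = 1 := by
      rw [← Real.rpow_add hr]; simp
    congr 1
    linear_combination ((V + D) ^ (1 / q) * N) * this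
  have hfin : morreyNorm p q f < ∞ := (key _ (lt_add_one _)).trans_lt ENNReal.ofReal_lt_top
  refine ⟨⟨hf.1, hfin⟩, ?_⟩
  have hC : 0 < (V + D) ^ (1 / q) := by positivity
  rw [← ENNReal.ofReal_toReal hf.2.ne, ← ENNReal.ofReal_mul hC.le,
    ENNReal.le_ofReal_iff_toReal_le hfin.ne (by positivity), ← div_le_iff₀' hC]
  refine le_of_forall_gt_imp_ge_of_dense fun N hN => ?_
  rw [div_le_iff₀' hC, ← ENNReal.le_ofReal_iff_toReal_le hfin.ne
    (mul_nonneg hC.le (ENNReal.toReal_nonneg.trans hN.le))]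
  exact key N hN

end WeakLp

/-! ### A sparse union of unit balls -/

section Counterexample

variable {E : Type*} [NormedAddCommGroup E] [NormedSpace ℝ E] {e : E}

theorem two_pow_le_dist_four_pow_smul (he : ‖e‖ = 1) {i j : ℕ} (hij : i < j) :
    (2 : ℝ) ^ j + 1 ≤ dist ((4 : ℝ) ^ i • e) ((4 : ℝ) ^ j • e) := by
  rw [dist_comm, dist_eq_norm, ← sub_smul, norm_smul, he, mul_one, Real.norm_eq_abs]
  refine le_trans ?_ (le_abs_self _)
  obtain ⟨m, rfl⟩ : ∃ m, j = m + 1 := ⟨j - 1, by omega⟩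
  have h1 : (4 : ℝ) ^ i ≤ 4 ^ m := pow_le_pow_right₀ (by norm_num) (by omega)
  have h2 : (1 : ℝ) ≤ 2 ^ m := one_le_pow₀ (by norm_num)
  have h3 : (4 : ℝ) ^ m = 2 ^ m * 2 ^ m := by rw [← mul_pow]; norm_num
  rw [pow_succ, pow_succ]
  nlinarith

/-- Unit balls with centers `4^j e`. -/
def sparseBalls (e : E) : Set E := ⋃ j : ℕ, Metric.ball ((4 : ℝ) ^ j • e) 1

theorem isOpen_sparseBalls (e : E) : IsOpen (sparseBalls e) :=
  isOpen_iUnion fun _ => Metric.isOpen_ball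

variable [MeasurableSpace E] [BorelSpace E] [FiniteDimensional ℝ E] (μ : Measure E)
  [μ.IsAddHaarMeasure]

theorem measure_sparseBalls (he : ‖e‖ = 1) : μ (sparseBalls e) = ∞ := by
  have hd : Pairwise (Function.onFun Disjoint fun j : ℕ => Metric.ball ((4 : ℝ) ^ j • e) 1) := by
    refine (pairwise_disjoint_on _).2 fun i j hij => ?_
    refine Metric.ball_disjoint_ball (le_trans ?_ (two_pow_le_dist_four_pow_smul he hij))
    linarith [one_le_pow₀ (M₀ := ℝ) (n := j) one_le_two]
  rw [sparseBalls, measure_iUnion hd fun _ => Metric.isOpen_ball.measurableSet]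
  simp only [Measure.addHaar_ball_center μ _ 1]
  exact ENNReal.tsum_const_eq_top_of_ne_zero (Metric.measure_ball_pos μ 0 one_pos).ne'

/-- The first `J` balls are counted outright. Of the later ones at most one meets `B(x,r)`: two
would have centers less than `2(r+1) ≤ 2^J` apart. -/
theorem measure_sparseBalls_inter_ball_le (he : ‖e‖ = 1) (x : E) {r : ℝ} {J : ℕ}
    (hJ : 2 * (r + 1) ≤ 2 ^ J) :
    μ (sparseBalls e ∩ Metric.ball x r) ≤ (J + 1) * μ (Metric.ball 0 1) := by
  have hfirst : μ (⋃ j ∈ Finset.range J, Metric.ball ((4 : ℝ) ^ j • e) 1) ≤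
      J * μ (Metric.ball 0 1) := by
    refine (measure_biUnion_finset_le _ _).trans_eq ?_
    simp [Measure.addHaar_ball_center μ _ 1]
  obtain ⟨i, hi⟩ : ∃ i : ℕ, ∀ j, J ≤ j →
      (Metric.ball ((4 : ℝ) ^ j • e) 1 ∩ Metric.ball x r).Nonempty → j = i := by
    by_contra! hcon
    -- The index `0` is arbitrary: it only yields some late ball `i` meeting `B(x,r)`, and negating
    -- again at `i` yields a second one.
    obtain ⟨i, hi, hi', -⟩ := hcon 0
    obtain ⟨j, hj, hj', hne⟩ := hcon i
    have hdist : ∀ k, (Metric.ball ((4 : ℝ) ^ k • e) 1 ∩ Metric.ball x r).Nonempty →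
        dist ((4 : ℝ) ^ k • e) x < r + 1 := by
      rintro k ⟨y, hy1, hy2⟩
      rw [Metric.mem_ball] at hy1 hy2
      linarith [dist_triangle_left ((4 : ℝ) ^ k • e) x y]
    have hlt : ∀ a b, J ≤ b → a < b → dist ((4 : ℝ) ^ a • e) x < r + 1 →
        dist ((4 : ℝ) ^ b • e) x < r + 1 → False := by
      intro a b hb hab ha' hb'
      have h1 := two_pow_le_dist_four_pow_smul he hab
      have h2 := dist_triangle_right ((4 : ℝ) ^ a • e) ((4 : ℝ) ^ b • e) x
      have h3 : (2 : ℝ) ^ J ≤ 2 ^ b := pow_le_pow_right₀ one_le_two hb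
      linarith
    rcases lt_or_gt_of_ne hne with h | h
    · exact hlt j i hi h (hdist j hj') (hdist i hi')
    · exact hlt i j hj h (hdist i hi') (hdist j hj')
  have hsub : sparseBalls e ∩ Metric.ball x r ⊆
      (⋃ j ∈ Finset.range J, Metric.ball ((4 : ℝ) ^ j • e) 1) ∪
        Metric.ball ((4 : ℝ) ^ i • e) 1 := by
    rintro y ⟨hy, hyx⟩
    obtain ⟨j, hj⟩ := mem_iUnion.1 hy
    rcases lt_or_ge j J with h | h
    · exact Or.inl (mem_biUnion (Finset.mem_coe.2 (Finset.mem_range.2 h)) hj)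
    · exact Or.inr (hi j h ⟨y, hj, hyx⟩ ▸ hj)
  refine (measure_mono hsub).trans ((measure_union_le _ _).trans ?_)
  rw [Measure.addHaar_ball_center μ _ 1, add_mul, one_mul]
  exact add_le_add_left hfirst _

/-- For `r ≤ 1` the volume `r^n` is below `r^δ`. For larger `r` the logarithmic count is absorbed
into `r^δ` by Bernoulli's inequality, which supplies `(2^δ - 1)⁻¹`. -/
theorem exists_measure_sparseBalls_inter_ball_le [Nontrivial E] (he : ‖e‖ = 1) {δ : ℝ}
    (hδ : 0 < δ) (hδn : δ ≤ Module.finrank ℝ E) :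
    ∃ C : ℝ, 0 ≤ C ∧ ∀ (x : E) (r : ℝ), 0 < r →
      μ (sparseBalls e ∩ Metric.ball x r) ≤
        ENNReal.ofReal (C * r ^ δ) * μ (Metric.ball 0 1) := by
  have h2δ : 0 < (2 : ℝ) ^ δ - 1 := sub_pos.2 (Real.one_lt_rpow one_lt_two hδ)
  refine ⟨4 + ((2 : ℝ) ^ δ - 1)⁻¹, by positivity, fun x r hr => ?_⟩
  have hC : 1 ≤ 4 + ((2 : ℝ) ^ δ - 1)⁻¹ := by linarith [inv_pos.2 h2δ]
  rcases le_total r 1 with h1 | h1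
  · refine (measure_mono inter_subset_right).trans ?_
    rw [Measure.addHaar_ball μ x hr.le]
    gcongr ENNReal.ofReal ?_ * _
    rw [← Real.rpow_natCast]
    calc r ^ (Module.finrank ℝ E : ℝ) ≤ r ^ δ := Real.rpow_le_rpow_of_exponent_ge hr h1 hδn
      _ ≤ _ := le_mul_of_one_le_left (by positivity) hC
  · obtain ⟨k, hk1, hk2⟩ := exists_nat_pow_near h1 (one_lt_two (α := ℝ))
    -- Since `1 ≤ r < 2^{k+1}`, one has `2(r+1) ≤ 4r < 2^{k+3}`.
    refine (measure_sparseBalls_inter_ball_le μ he x (J := k + 3) ?_).trans ?_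
    · rw [pow_add] at hk2 ⊢; linarith
    · gcongr
      rw [show ((k + 3 : ℕ) : ℝ≥0∞) + 1 = ENNReal.ofReal ((k : ℝ) + 4) by
        rw [ENNReal.ofReal_add (by positivity) (by norm_num)]; push_cast; norm_num; ring]
      refine ENNReal.ofReal_le_ofReal ?_
      have hb := one_add_mul_le_pow (a := (2 : ℝ) ^ δ - 1) (by linarith) k
      have hpow : (1 + ((2 : ℝ) ^ δ - 1)) ^ k ≤ r ^ δ := by
        rw [add_sub_cancel, ← Real.rpow_natCast, ← Real.rpow_mul two_pos.le, mul_comm,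
          Real.rpow_mul two_pos.le, Real.rpow_natCast]
        gcongr
      have hr1 : 1 ≤ r ^ δ := Real.one_le_rpow h1 hδ.le
      have hk : (k : ℝ) ≤ ((2 : ℝ) ^ δ - 1)⁻¹ * r ^ δ := by
        rw [inv_mul_eq_div, le_div_iff₀ h2δ]; linarith
      linarith

end Counterexample

/-! ### Properness of the embedding -/

section Proper

variable {n : ℕ} {𝕜 : Type*} [RCLike 𝕜] {p q : ℝ}

theorem exists_memMorrey_not_memWeakLp (hn : 1 ≤ n) (hq : 0 < q) (hqp : q < p) :
    ∃ f : EuclideanSpace ℝ (Fin n) → 𝕜, MemMorrey p q f ∧ ¬ MemWeakLp p f := by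
  have : Nonempty (Fin n) := ⟨⟨0, hn⟩⟩
  have hp : 0 < p := hq.trans hqp
  have hn0 : (0 : ℝ) < n := by exact_mod_cast hn
  obtain ⟨e, he⟩ := exists_norm_eq (EuclideanSpace ℝ (Fin n)) zero_le_one
  have hS : MeasurableSet (sparseBalls e) := (isOpen_sparseBalls e).measurableSet
  -- This `δ = n - nq/p` is exactly the growth of `∫_{B(x,r)} |f|^q` that the Morrey norm permits.
  have hδ : 0 < ((n : ℝ) / q - n / p) * q :=
    mul_pos (sub_pos.2 (div_lt_div_of_pos_left hn0 hq hqp)) hq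
  have hδn : ((n : ℝ) / q - n / p) * q ≤
      Module.finrank ℝ (EuclideanSpace ℝ (Fin n)) := by
    rw [finrank_euclideanSpace_fin, sub_mul, div_mul_cancel₀ _ hq.ne']
    have : 0 ≤ (n : ℝ) / p * q := by positivity
    linarith
  obtain ⟨C, hC, hle⟩ := exists_measure_sparseBalls_inter_ball_le volume he hδ hδn
  have hmeas : AEStronglyMeasurable ((sparseBalls e).indicator fun _ => (1 : 𝕜)) volume :=
    aestronglyMeasurable_const.indicator hS
  refine ⟨(sparseBalls e).indicator fun _ => 1, ⟨hmeas, ?_⟩, fun h => ?_⟩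
  · set V := volume (Metric.ball (0 : EuclideanSpace ℝ (Fin n)) 1)
    have hV : V ≠ ∞ := measure_ball_lt_top.ne
    have hfin : (ENNReal.ofReal C * V) ^ (1 / q) < ∞ :=
      ENNReal.rpow_lt_top_of_nonneg (by positivity) (ENNReal.mul_ne_top ENNReal.ofReal_ne_top hV)
    refine lt_of_le_of_lt (iSup_le fun x => iSup₂_le fun r hr => ?_) hfin
    rw [eLpNorm_indicator_const hS (by simpa using hq) ENNReal.ofReal_ne_top,
      Measure.restrict_apply hS, ENNReal.toReal_ofReal hq.le, enorm_one, one_mul]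
    refine (mul_le_mul_right (ENNReal.rpow_le_rpow (hle x r hr) (by positivity)) _).trans_eq ?_
    rw [ENNReal.ofReal_mul hC, mul_right_comm, ENNReal.mul_rpow_of_nonneg _ _ (by positivity),
      ENNReal.ofReal_rpow_of_nonneg (by positivity) (by positivity), ← Real.rpow_mul hr.le,
      mul_assoc, mul_one_div_cancel hq.ne', mul_one, mul_left_comm,
      ← ENNReal.ofReal_mul (by positivity), ← Real.rpow_add hr]
    simp
  · have h1 := meas_lt_norm_le hp hmeas one_half_pos
    have hset : {x | 1 / 2 < ‖(sparseBalls e).indicator (fun _ => (1 : 𝕜)) x‖} =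
        sparseBalls e := by
      ext x
      by_cases hx : x ∈ sparseBalls e
      · simpa [hx] using (by norm_num : (2 : ℝ)⁻¹ < 1)
      · simp [hx]
    rw [hset, measure_sparseBalls volume he, top_le_iff] at h1
    exact ENNReal.mul_ne_top (ENNReal.rpow_ne_top_of_nonneg hp.le h.2.ne)
      ENNReal.ofReal_ne_top h1

end Proper

end HeatMorrey

/-! ### Assembly of the theorem -/

theorem mainTheorem1 {𝕜 : Type*} [RCLike 𝕜] (n : ℕ) (hn : 1 ≤ n) (p q s γ : ℝ)
    (hq : 1 < q) (hqp : q ≤ p) (hs : 1 < s) (hγ : 0 < γ)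
    (hγ_lower : (n : ℝ) / q - (n : ℝ) / p < γ) (hγ_upper : γ < (n : ℝ) - (n : ℝ) / p) :
    -- the integral that defines `e^{tΔ}[|·|^{-γ} f](x)` converges absolutely at every point
    (∀ t : ℝ, 0 < t → ∀ f : EuclideanSpace ℝ (Fin n) → 𝕜, HeatMorrey.MemMorrey p q f →
      ∀ x : EuclideanSpace ℝ (Fin n),
        Integrable (fun y : EuclideanSpace ℝ (Fin n) =>
          Real.exp (-(‖x - y‖ ^ 2 / (4 * t))) • HeatMorrey.weighted γ f y) volume) ∧
    -- (1)
    (q ≤ s → ∃ C : ℝ, 0 < C ∧ ∀ t : ℝ, 0 < t →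
      ∀ f : EuclideanSpace ℝ (Fin n) → 𝕜, HeatMorrey.MemMorrey p q f →
        HeatMorrey.MemWeakLp s (HeatMorrey.heatSemigroup t (HeatMorrey.weighted γ f)) ∧
        HeatMorrey.weakLpNorm s (HeatMorrey.heatSemigroup t (HeatMorrey.weighted γ f)) ≤
          ENNReal.ofReal (C * t ^ (-((n : ℝ) / 2) * (1 / p - 1 / s) - γ / 2)) *
            HeatMorrey.morreyNorm p q f) ∧
    -- (2)
    (q < s → ∃ C : ℝ, 0 < C ∧ ∀ t : ℝ, 0 < t →
      ∀ f : EuclideanSpace ℝ (Fin n) → 𝕜, HeatMorrey.MemMorrey p q f →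
        MemLp (HeatMorrey.heatSemigroup t (HeatMorrey.weighted γ f))
          (ENNReal.ofReal s) volume ∧
        eLpNorm (HeatMorrey.heatSemigroup t (HeatMorrey.weighted γ f))
            (ENNReal.ofReal s) volume ≤
          ENNReal.ofReal (C * t ^ (-((n : ℝ) / 2) * (1 / p - 1 / s) - γ / 2)) *
            HeatMorrey.morreyNorm p q f) ∧
    -- (3) for `q < p`, the embedding of `L^{p,∞}` into `M^p_q`, and it is proper
    (q < p →
      (∃ C : ℝ, 0 < C ∧ ∀ f : EuclideanSpace ℝ (Fin n) → 𝕜, HeatMorrey.MemWeakLp p f →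
        HeatMorrey.MemMorrey p q f ∧
        HeatMorrey.morreyNorm p q f ≤ ENNReal.ofReal C * HeatMorrey.weakLpNorm p f) ∧
      ∃ f : EuclideanSpace ℝ (Fin n) → 𝕜,
        HeatMorrey.MemMorrey p q f ∧ ¬ HeatMorrey.MemWeakLp p f) := by
  have hn' : Nonempty (Fin n) := ⟨⟨0, hn⟩⟩
  have hq0 : 0 < q := zero_lt_one.trans hq
  refine ⟨fun t ht f hf x => HeatMorrey.integrable_exp_smul_weighted hn hq hγ hγ_lower
      hγ_upper ht hf x, fun hqs => ?_, fun hqs => ?_, fun hqp' => ?_⟩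
  · obtain ⟨C, hC, h⟩ := HeatMorrey.exists_eLpNorm_heatSemigroup_weighted_le (𝕜 := 𝕜) hn hq hγ
      hγ_lower hγ_upper hqs
    refine ⟨C, hC, fun t ht f hf => ?_⟩
    obtain ⟨hmem, hle⟩ := h t ht f hf
    exact ⟨⟨hmem.1, (HeatMorrey.weakLpNorm_le_eLpNorm s _).trans_lt hmem.2⟩,
      (HeatMorrey.weakLpNorm_le_eLpNorm s _).trans hle⟩
  · exact HeatMorrey.exists_eLpNorm_heatSemigroup_weighted_le hn hq hγ hγ_lower hγ_upper hqs.le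
  · exact ⟨HeatMorrey.exists_morreyNorm_le_weakLpNorm hq0 hqp',
      HeatMorrey.exists_memMorrey_not_memWeakLp hn hq0 hqp'⟩
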